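/- Let $d\ge 2$ and let $\mathbf M=\{M_1,\dots,M_{d^2}\}$ be a SIC measurement in dimension $d$, i.e. a POVM on $\mathbb C^d$ of the form $M_i=\frac1d|\phi_i\rangle\langle\phi_i|$ with unit vectors $\phi_i\in\mathbb C^d$ satisfying $|\langle\phi_j|\phi_i\rangle|^2=\frac1{d+1}$ for all $i\ne j$. All logarithms are to base $2$. For a projection-valued measure $\mathbf P=\{P_i\}$ on a finite-dimensional Hilbert space and a state $\varrho$ on it, put $\Delta_{\mathbf P}(\varrho)=\sum_iP_i\varrho P_i$ and $$R_c(\varrho,\mathbf P)=\inf\sum_jq_j\,S\big(\Delta_{\mathbf P}(|\psi_j\rangle\langle\psi_j|)\big),\qquad R_q(\varrho,\mathbf P)=S\big(\varrho\,\|\,\Delta_{\mathbf P}(\varrho)\big),$$ where the infimum is over all finite decompositions $\varrho=\sum_jq_j|\psi_j\rangle\langle\psi_j|$ with $q_j\ge0$, $\sum_jq_j=1$ and unit vectors $\psi_j$, where $S(\varrho)=-\mathrm{tr}(\varrho\log\varrho)$ is the von Neumann entropy, and where $S(\varrho\|\tau)=\mathrm{tr}(\varrho\log\varrho-\varrho\log\tau)$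 is the quantum relative entropy. For $R\in\{R_c,R_q\}$ and a state $\rho$ on $\mathbb C^d$ let $$R(\rho,\mathbf M)=\inf_{(\mathbf P,\sigma)}R(\rho\otimes\sigma,\mathbf P),\qquad R(\mathbf M)=\inf_\rho R(\rho,\mathbf M),$$ where $(\mathbf P,\sigma)$ ranges over all generalized Naimark extensions of $\mathbf M$: $\sigma$ is a (possibly mixed) state of an ancilla $Q$ of arbitrary finite dimension, and $\mathbf P=\{P_1,\dots,P_{d^2}\}$ is a projection-valued measure on $\mathbb C^d\otimes Q$ with $M_i=\mathrm{tr}_Q[P_i(\mathbf 1\otimes\sigma)]$ for all $i$. Then, for $R=R_c$ and for $R=R_q$, $$R(\mathbf M)>\log\Big(\frac{d+1}2\Big).$$ -/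

import Mathlib

open Matrix
open scoped ComplexOrder Kronecker

noncomputable section

/-- A quantum state on `ℂ^κ`: a positive semidefinite matrix of trace one. -/
def IsState {κ : Type} [Fintype κ] (ρ : Matrix κ κ ℂ) : Prop :=
  ρ.PosSemidef ∧ ρ.trace = 1

/-- The rank-one operator `|ψ⟩⟨ψ|`. -/
def ketbra {κ : Type} (ψ : κ → ℂ) : Matrix κ κ ℂ :=
  vecMulVec ψ (star ψ)

/-- `⟨ψ|ψ⟩ = 1`. -/
def IsUnitVec {κ : Type} [Fintype κ] (ψ : κ → ℂ) : Prop :=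
  star ψ ⬝ᵥ ψ = 1

/-- A POVM with outcomes in `ι`: positive semidefinite matrices summing to the identity. -/
def IsPOVM {ι κ : Type} [Fintype ι] [Fintype κ] [DecidableEq κ]
    (M : ι → Matrix κ κ ℂ) : Prop :=
  (∀ i, (M i).PosSemidef) ∧ ∑ i, M i = 1

/-- A projection-valued measure with outcomes in `ι`: mutually orthogonal orthogonal projections
summing to the identity. -/
def IsPVM {ι κ : Type} [Fintype ι] [Fintype κ] [DecidableEq κ]
    (P : ι → Matrix κ κ ℂ) : Prop :=
  (∀ i, (P i).IsHermitian ∧ P i * P i = P i) ∧ (∀ i j, i ≠ j → P i * P j = 0) ∧ ∑ i, P i = 1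

/-- The block-dephasing operation `Δ_P(ρ) = ∑ i, P_i ρ P_i`. -/
def dephase {ι κ : Type} [Fintype ι] [Fintype κ]
    (P : ι → Matrix κ κ ℂ) (ρ : Matrix κ κ ℂ) : Matrix κ κ ℂ :=
  ∑ i, P i * ρ * P i

/-- The base-2 logarithm of a Hermitian matrix, applied to its eigenvalues
(with value `0` at the eigenvalue `0`, the convention `0 log 0 = 0`). -/
def matLog {κ : Type} [Fintype κ] [DecidableEq κ] (ρ : Matrix κ κ ℂ) : Matrix κ κ ℂ :=
  cfc (Real.logb 2) ρ

/-- The von Neumann entropy `S(ρ) = -tr(ρ log ρ)`, in bits. -/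
def vnEntropy {κ : Type} [Fintype κ] [DecidableEq κ] (ρ : Matrix κ κ ℂ) : ℝ :=
  -((ρ * matLog ρ).trace).re

/-- The quantum relative entropy `S(ρ‖σ) = tr(ρ log ρ - ρ log σ)`, in bits, for states with
`ker σ ≤ ker ρ` (for which alone it is finite); this always holds for `σ = Δ_P(ρ)`, the only
case used below: see `mulVec_eq_zero_of_dephase`. -/
def relEntropy {κ : Type} [Fintype κ] [DecidableEq κ] (ρ σ : Matrix κ κ ℂ) : ℝ :=
  ((ρ * matLog ρ - ρ * matLog σ).trace).re

/-- `ker Δ_P(ρ) ≤ ker ρ`, so that `S(ρ‖Δ_P(ρ))` is finite. -/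
theorem mulVec_eq_zero_of_dephase {ι κ : Type} [Fintype ι] [Fintype κ] [DecidableEq κ]
    {P : ι → Matrix κ κ ℂ} (hP : IsPVM P) {ρ : Matrix κ κ ℂ} (hρ : ρ.PosSemidef)
    {v : κ → ℂ} (hv : dephase P ρ *ᵥ v = 0) : ρ *ᵥ v = 0 := by
  have key : ∀ i, star v ⬝ᵥ ((P i * ρ * P i) *ᵥ v) = star (P i *ᵥ v) ⬝ᵥ (ρ *ᵥ (P i *ᵥ v)) := by
    intro i
    rw [star_mulVec, (hP.1 i).1.eq, ← dotProduct_mulVec, mulVec_mulVec, mulVec_mulVec,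
      Matrix.mul_assoc]
  have h0 : ∑ i, star (P i *ᵥ v) ⬝ᵥ (ρ *ᵥ (P i *ᵥ v)) = 0 := by
    rw [← Finset.sum_congr rfl (fun i _ => key i), ← dotProduct_sum, ← sum_mulVec]
    change star v ⬝ᵥ (dephase P ρ *ᵥ v) = 0
    rw [hv, dotProduct_zero]
  have h1 := (Finset.sum_eq_zero_iff_of_nonneg
    (fun i _ => hρ.dotProduct_mulVec_nonneg (P i *ᵥ v))).1 h0
  have h2 : ∀ i, ρ *ᵥ (P i *ᵥ v) = 0 := fun i =>
    (hρ.dotProduct_mulVec_zero_iff _).1 (h1 i (Finset.mem_univ i))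
  calc ρ *ᵥ v = ρ *ᵥ ((∑ i, P i) *ᵥ v) := by rw [hP.2.2, one_mulVec]
    _ = ∑ i, ρ *ᵥ (P i *ᵥ v) := by rw [sum_mulVec, mulVec_sum]
    _ = 0 := Finset.sum_eq_zero fun i _ => h2 i

/-- `R_c(ρ, P)`: the infimum of `∑ j, q_j S(Δ_P(|ψ_j⟩⟨ψ_j|))` over all finite decompositions
`ρ = ∑ j, q_j |ψ_j⟩⟨ψ_j|` into pure states. -/
def pvmRandC {ι κ : Type} [Fintype ι] [Fintype κ] [DecidableEq κ]
    (ρ : Matrix κ κ ℂ) (P : ι → Matrix κ κ ℂ) : ℝ :=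
  sInf {r : ℝ | ∃ (k : ℕ) (q : Fin k → ℝ) (ψ : Fin k → κ → ℂ),
    (∀ j, 0 ≤ q j) ∧ ∑ j, q j = 1 ∧ (∀ j, IsUnitVec (ψ j)) ∧
    ρ = ∑ j, (q j : ℂ) • ketbra (ψ j) ∧
    r = ∑ j, q j * vnEntropy (dephase P (ketbra (ψ j)))}

/-- `R_q(ρ, P) = S(ρ‖Δ_P(ρ))`. -/
def pvmRandQ {ι κ : Type} [Fintype ι] [Fintype κ] [DecidableEq κ]
    (ρ : Matrix κ κ ℂ) (P : ι → Matrix κ κ ℂ) : ℝ :=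
  relEntropy ρ (dephase P ρ)

/-- The partial trace over the second tensor factor. -/
def traceQ {α β : Type} [Fintype β] (X : Matrix (α × β) (α × β) ℂ) : Matrix α α ℂ :=
  Matrix.of fun a a' => ∑ b, X (a, b) (a', b)

/-- `(P, σ)` is a generalized Naimark extension of `M`: a PVM on the system and an ancilla, and
a (possibly mixed) ancilla state, with `M_i = tr_Q[P_i (1 ⊗ σ)]` for all `i`. -/
def IsNaimarkExt {ι : Type} [Fintype ι] {d n : ℕ} (M : ι → Matrix (Fin d) (Fin d) ℂ)
    (P : ι → Matrix (Fin d × Fin n) (Fin d × Fin n) ℂ) (σ : Matrix (Fin n) (Fin n) ℂ) : Prop :=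
  IsPVM P ∧ IsState σ ∧
    ∀ i, M i = traceQ (P i * ((1 : Matrix (Fin d) (Fin d) ℂ) ⊗ₖ σ))

/-- `R(ρ, M)`: the infimum of `R(ρ ⊗ σ, P)` over all generalized Naimark extensions `(P, σ)` of
the POVM `M`, with an ancilla of any finite dimension `n`; here `R` is a randomness function
for PVMs. -/
def povmRand {ι : Type} [Fintype ι] {d : ℕ}
    (R : ∀ {κ : Type} [Fintype κ] [DecidableEq κ], Matrix κ κ ℂ → (ι → Matrix κ κ ℂ) → ℝ)
    (ρ : Matrix (Fin d) (Fin d) ℂ) (M : ι → Matrix (Fin d) (Fin d) ℂ) : ℝ :=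
  sInf {r : ℝ | ∃ (n : ℕ) (P : ι → Matrix (Fin d × Fin n) (Fin d × Fin n) ℂ)
    (σ : Matrix (Fin n) (Fin n) ℂ), IsNaimarkExt M P σ ∧ r = R (ρ ⊗ₖ σ) P}

/-- The source-independent randomness `R(M)`: the infimum of `R(ρ, M)` over all states `ρ`. -/
def sourceIndepRand {ι : Type} [Fintype ι] {d : ℕ}
    (R : ∀ {κ : Type} [Fintype κ] [DecidableEq κ], Matrix κ κ ℂ → (ι → Matrix κ κ ℂ) → ℝ)
    (M : ι → Matrix (Fin d) (Fin d) ℂ) : ℝ :=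
  sInf {r : ℝ | ∃ ρ : Matrix (Fin d) (Fin d) ℂ, IsState ρ ∧ r = povmRand R ρ M}

/-- A SIC measurement in dimension `d`: a POVM with the `d²` elements `|φ_i⟩⟨φ_i| / d`, where the
`φ_i` are unit vectors with `|⟨φ_j|φ_i⟩|² = 1 / (d + 1)` for `i ≠ j`. -/
def IsSIC {d : ℕ} (M : Fin (d ^ 2) → Matrix (Fin d) (Fin d) ℂ) : Prop :=
  IsPOVM M ∧ ∃ φ : Fin (d ^ 2) → Fin d → ℂ,
    (∀ i, IsUnitVec (φ i)) ∧
    (∀ i j, i ≠ j → ‖star (φ j) ⬝ᵥ φ i‖ ^ 2 = 1 / ((d : ℝ) + 1)) ∧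
    ∀ i, M i = (1 / (d : ℂ)) • ketbra (φ i)

end

/-! A SIC leaves almost no freedom in its Naimark extensions. Write `σ = A Aᴴ`. Compressing `P i` by
`1 ⊗ A` gives a positive operator whose marginal is the rank-one `M i`, so it is a product
`|φ_i⟩⟨φ_i| ⊗ τ i`. These products sum to `1 ⊗ Aᴴ A`, and the SIC projectors are linearly
independent, so every `τ i` equals `Aᴴ A / d` (`naimark_compress`).

With `p` the outcome distribution of `M` on `ρ`, this gives `R_q = H(p) - S(ρ)` for every extension
(`pvmRandQ_naimark`). For `R_c`, every vector of nonzero weight in a decomposition of `ρ ⊗ σ` lies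
in the range of `1 ⊗ σ`, so its outcomes are distributed as those of `M` on its reduced state, and
its dephased entropy is the Shannon entropy of that distribution.

In both cases it suffices to bound `H(p) - S(ρ)` below. Collision entropy and the SIC purity bound
give `H(p) ≥ log (d(d+1) / (1 + tr ρ²))`. Moreover `S(ρ) + log (1 + tr ρ²) < log (2d)`: the terms
are at most `log d` and `log 2`, and the second is attained only by pure states, where `S = 0`.
Compactness of the simplex of spectra makes the gap uniform, so strictness survives the infima. -/

noncomputable section

/-! ### Entropy through spectra and Gram matrices -/

/-- The function `x ↦ -x log₂ x`. -/
def entropyTerm (x : ℝ) : ℝ := Real.negMulLog x / Real.log 2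

lemma entropyTerm_zero : entropyTerm 0 = 0 := by simp [entropyTerm]

lemma entropyTerm_mul (x y : ℝ) :
    entropyTerm (x * y) = y * entropyTerm x + x * entropyTerm y := by
  simp only [entropyTerm, Real.negMulLog_mul]; ring

lemma entropyTerm_eq (x : ℝ) : entropyTerm x = -(x * Real.logb 2 x) := by
  simp only [entropyTerm, Real.negMulLog, Real.logb]; ring

section
variable {κ ν : Type} [Fintype κ] [DecidableEq κ] [Fintype ν] [DecidableEq ν]

lemma vnEntropy_eq_sum_eigenvalues {ρ : Matrix κ κ ℂ} (hρ : ρ.IsHermitian) :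
    vnEntropy ρ = ∑ i, entropyTerm (hρ.eigenvalues i) := by
  have h1 : ρ * matLog ρ = cfc (fun x => x * Real.logb 2 x) ρ := by
    have hs : IsSelfAdjoint ρ := hρ
    have hf : (spectrum ℝ ρ).Finite := finite_real_spectrum
    rw [matLog, cfc_mul (fun x : ℝ => x) (Real.logb 2) ρ (hf.continuousOn _) (hf.continuousOn _),
      cfc_id' ℝ ρ]
  rw [vnEntropy, h1, hρ.cfc_eq, IsHermitian.cfc, Unitary.conjStarAlgAut_apply, trace_mul_comm,
    ← mul_assoc]
  simp [trace_diagonal, entropyTerm_eq]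

lemma vnEntropy_eq_sum_roots {ρ : Matrix κ κ ℂ} (hρ : ρ.IsHermitian) :
    vnEntropy ρ = (ρ.charpoly.roots.map (fun z => entropyTerm z.re)).sum := by
  rw [vnEntropy_eq_sum_eigenvalues hρ, hρ.roots_charpoly_eq_eigenvalues]
  simp

open Polynomial in
lemma sum_roots_X_pow_mul (a : ℕ) {f : ℂ[X]} (hf : f ≠ 0) :
    ((X ^ a * f).roots.map (fun z : ℂ => entropyTerm z.re)).sum =
      (f.roots.map (fun z : ℂ => entropyTerm z.re)).sum := by
  rw [roots_mul (mul_ne_zero (pow_ne_zero _ X_ne_zero) hf), roots_X_pow]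
  simp [entropyTerm_zero, Multiset.map_nsmul, Multiset.sum_nsmul]

/-- The two characteristic polynomials agree up to powers of `X`, and zero eigenvalues contribute no
entropy. -/
lemma vnEntropy_mul_conjTranspose_self (B : Matrix κ ν ℂ) :
    vnEntropy (B * Bᴴ) = vnEntropy (Bᴴ * B) := by
  rw [vnEntropy_eq_sum_roots (isHermitian_mul_conjTranspose_self B),
    vnEntropy_eq_sum_roots (isHermitian_conjTranspose_mul_self B),
    ← sum_roots_X_pow_mul (Fintype.card ν) (charpoly_monic _).ne_zero,
    charpoly_mul_comm', sum_roots_X_pow_mul _ (charpoly_monic _).ne_zero]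

lemma vnEntropy_conj_diagonal {W : Matrix κ κ ℂ} (hW : Wᴴ * W = 1) (x : κ → ℝ) :
    vnEntropy (W * diagonal (fun i => (x i : ℂ)) * Wᴴ) = ∑ i, entropyTerm (x i) := by
  have hD : (diagonal (fun i => (x i : ℂ))).IsHermitian := by
    rw [isHermitian_diagonal_iff]; intro i; simp [IsSelfAdjoint]
  rw [vnEntropy_eq_sum_roots (isHermitian_mul_mul_conjTranspose W hD), charpoly_mul_comm,
    ← mul_assoc, hW, one_mul, charpoly_diagonal, Polynomial.roots_prod]
  · simp
  · exact Finset.prod_ne_zero_iff.2 fun i _ => Polynomial.X_sub_C_ne_zero _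

lemma vnEntropy_diagonal (x : κ → ℝ) :
    vnEntropy (diagonal (fun i => (x i : ℂ))) = ∑ i, entropyTerm (x i) := by
  simpa using vnEntropy_conj_diagonal (W := (1 : Matrix κ κ ℂ)) (by simp) x

lemma Matrix.IsHermitian.eq_conj_diagonal {ρ : Matrix κ κ ℂ} (hρ : ρ.IsHermitian) :
    ∃ W : Matrix κ κ ℂ, Wᴴ * W = 1 ∧
      ρ = W * diagonal (fun i => (hρ.eigenvalues i : ℂ)) * Wᴴ := by
  refine ⟨hρ.eigenvectorUnitary, ?_, ?_⟩
  · rw [← star_eq_conjTranspose]; simp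
  · conv_lhs => rw [hρ.spectral_theorem, Unitary.conjStarAlgAut_apply]
    rfl

lemma vnEntropy_kronecker {A : Matrix κ κ ℂ} {B : Matrix ν ν ℂ} (hA : A.IsHermitian)
    (hB : B.IsHermitian) :
    vnEntropy (A ⊗ₖ B) = vnEntropy A * B.trace.re + A.trace.re * vnEntropy B := by
  obtain ⟨U, hU, hAU⟩ := hA.eq_conj_diagonal
  obtain ⟨V, hV, hBV⟩ := hB.eq_conj_diagonal
  have hW : (U ⊗ₖ V)ᴴ * (U ⊗ₖ V) = 1 := by
    rw [conjTranspose_kronecker, ← mul_kronecker_mul, hU, hV, one_kronecker_one]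
  have h : A ⊗ₖ B = (U ⊗ₖ V) * diagonal (fun m : κ × ν =>
      ((hA.eigenvalues m.1 * hB.eigenvalues m.2 : ℝ) : ℂ)) * (U ⊗ₖ V)ᴴ := by
    conv_lhs => rw [hAU, hBV]
    rw [mul_kronecker_mul, mul_kronecker_mul, diagonal_kronecker_diagonal,
      conjTranspose_kronecker]
    simp
  rw [h, vnEntropy_conj_diagonal hW, vnEntropy_eq_sum_eigenvalues hA,
    vnEntropy_eq_sum_eigenvalues hB, hA.trace_eq_sum_eigenvalues, hB.trace_eq_sum_eigenvalues,
    Fintype.sum_prod_type]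
  simp only [entropyTerm_mul, Finset.sum_add_distrib, Complex.re_sum, Complex.coe_algebraMap,
    Complex.ofReal_re, ← Finset.mul_sum, ← Finset.sum_mul]
  simp [mul_comm, Finset.mul_sum, Finset.sum_mul]

/-- The entropy of a dephased state, through the Gram matrix of the vectors `P i * S`. -/
lemma vnEntropy_dephase {ι : Type} [Fintype ι] [DecidableEq ι] {P : ι → Matrix κ κ ℂ}
    (hP : IsPVM P) (S : Matrix κ ν ℂ) :
    vnEntropy (dephase P (S * Sᴴ)) = vnEntropy (blockDiagonal fun i => Sᴴ * P i * S) := by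
  -- The blocks `P i * S` side by side: `B * Bᴴ` is the dephased operator, while orthogonality of
  -- the `P i` makes `Bᴴ * B` block diagonal.
  let B : Matrix κ (ν × ι) ℂ := of fun k m => (P m.2 * S) k m.1
  have h1 : dephase P (S * Sᴴ) = B * Bᴴ := by
    have h : ∀ i, P i * (S * Sᴴ) * P i = (P i * S) * (P i * S)ᴴ := fun i => by
      rw [conjTranspose_mul, (hP.1 i).1.eq]; simp only [Matrix.mul_assoc]
    ext k l
    simp only [dephase, h, Matrix.sum_apply, mul_apply (M := B), Fintype.sum_prod_type_right]
    refine Finset.sum_congr rfl fun i _ => ?_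
    rw [mul_apply]
    rfl
  have h2 : (blockDiagonal fun i => Sᴴ * P i * S) = Bᴴ * B := by
    ext ⟨m, i⟩ ⟨m', j⟩
    have h : (Bᴴ * B) (m, i) (m', j) = ((P i * S)ᴴ * (P j * S)) m m' := by
      rw [mul_apply, mul_apply]; rfl
    have h' : (P i * S)ᴴ * (P j * S) = Sᴴ * (P i * P j) * S := by
      rw [conjTranspose_mul, (hP.1 i).1.eq]; simp only [Matrix.mul_assoc]
    rw [h, h', blockDiagonal_apply]
    split_ifs with hij
    · change i = j at hij
      subst hij
      rw [(hP.1 i).2]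
    · rw [hP.2.1 i j hij]; simp
  rw [h1, h2, vnEntropy_mul_conjTranspose_self]

lemma vnEntropy_blockDiagonal_mul_conjTranspose_self {ι μ : Type} [Fintype ι] [DecidableEq ι]
    [Fintype μ] [DecidableEq μ] (C : ι → Matrix ν μ ℂ) :
    vnEntropy (blockDiagonal fun i => C i * (C i)ᴴ) =
      vnEntropy (blockDiagonal fun i => (C i)ᴴ * C i) := by
  rw [blockDiagonal_mul, blockDiagonal_mul, ← blockDiagonal_conjTranspose,
    vnEntropy_mul_conjTranspose_self]

/-- The logarithm of `Δ_P(ρ)` commutes with every `P i`, so its trace against `ρ` does not change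
when `ρ` is dephased. -/
lemma pvmRandQ_eq {ι : Type} [Fintype ι] {P : ι → Matrix κ κ ℂ} (hP : IsPVM P)
    (ρ : Matrix κ κ ℂ) :
    pvmRandQ ρ P = vnEntropy (dephase P ρ) - vnEntropy ρ := by
  set D := dephase P ρ with hD
  have hPD : ∀ i, P i * D = P i * ρ * P i ∧ D * P i = P i * ρ * P i := fun i => by
    constructor
    · rw [hD, dephase, Finset.mul_sum, Finset.sum_eq_single i]
      · simp only [← Matrix.mul_assoc, (hP.1 i).2]
      · intro j _ hj
        simp only [← Matrix.mul_assoc, hP.2.1 i j hj.symm, Matrix.zero_mul]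
      · simp
    · rw [hD, dephase, Finset.sum_mul, Finset.sum_eq_single i]
      · simp only [Matrix.mul_assoc, (hP.1 i).2]
      · intro j _ hj
        simp only [Matrix.mul_assoc, hP.2.1 j i hj, Matrix.mul_zero]
      · simp
  have hc : ∀ i, Commute (matLog D) (P i) := fun i =>
    Commute.cfc_real (show D * P i = P i * D by rw [(hPD i).1, (hPD i).2]) _
  have key : (ρ * matLog D).trace = (D * matLog D).trace := by
    calc (ρ * matLog D).trace = ∑ i, (ρ * matLog D * P i).trace := by
          rw [← trace_sum, ← Finset.mul_sum, hP.2.2, Matrix.mul_one]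
      _ = ∑ i, (P i * ρ * P i * matLog D).trace := by
          refine Finset.sum_congr rfl fun i _ => ?_
          have e : P i * ρ * P i * matLog D = P i * (ρ * matLog D * P i) := by
            rw [Matrix.mul_assoc _ (P i), ← (hc i).eq]; simp only [Matrix.mul_assoc]
          rw [e, trace_mul_comm (P i), Matrix.mul_assoc _ (P i), (hP.1 i).2]
      _ = _ := by
          rw [← trace_sum, ← Finset.sum_mul]; rfl
  rw [pvmRandQ, relEntropy, trace_sub, key, vnEntropy, vnEntropy, Complex.sub_re]
  ring

end

/-! ### Rank-one operators and partial traces -/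

lemma Matrix.PosSemidef.exists_eq_conjTranspose_mul_self {κ : Type} [Fintype κ]
    {ρ : Matrix κ κ ℂ} (hρ : ρ.PosSemidef) : ∃ L : Matrix κ κ ℂ, ρ = Lᴴ * L := by
  classical
  open scoped MatrixOrder in
  exact CStarAlgebra.nonneg_iff_eq_star_mul_self.mp hρ.nonneg

lemma Matrix.PosSemidef.exists_eq_mul_conjTranspose_self {κ : Type} [Fintype κ]
    {ρ : Matrix κ κ ℂ} (hρ : ρ.PosSemidef) : ∃ L : Matrix κ κ ℂ, ρ = L * Lᴴ := by
  obtain ⟨L, hL⟩ := hρ.exists_eq_conjTranspose_mul_self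
  exact ⟨Lᴴ, by rw [hL, conjTranspose_conjTranspose]⟩

lemma star_mul_self_ofReal (z : ℂ) : star z * z = ((‖z‖ ^ 2 : ℝ) : ℂ) := by
  rw [Complex.star_def, mul_comm, Complex.mul_conj, Complex.normSq_eq_norm_sq]

lemma ketbra_eq_replicateCol {κ : Type} (φ : κ → ℂ) :
    ketbra φ = replicateCol Unit φ * (replicateCol Unit φ)ᴴ := by
  rw [ketbra, vecMulVec_eq Unit, conjTranspose_replicateCol]

lemma isHermitian_ketbra {κ : Type} (φ : κ → ℂ) : (ketbra φ).IsHermitian := by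
  rw [ketbra_eq_replicateCol]; exact isHermitian_mul_conjTranspose_self _

section
variable {κ : Type} [Fintype κ]

lemma posSemidef_ketbra (φ : κ → ℂ) : (ketbra φ).PosSemidef := by
  rw [ketbra_eq_replicateCol]; exact posSemidef_self_mul_conjTranspose _

lemma trace_mul_ketbra (X : Matrix κ κ ℂ) (φ : κ → ℂ) :
    (X * ketbra φ).trace = star φ ⬝ᵥ X *ᵥ φ := by
  rw [ketbra, mul_vecMulVec, trace_vecMulVec, dotProduct_comm]

lemma trace_ketbra {φ : κ → ℂ} (hφ : IsUnitVec φ) : (ketbra φ).trace = 1 := by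
  rw [ketbra, trace_vecMulVec, dotProduct_comm, hφ]

lemma ketbra_mul_ketbra (φ χ : κ → ℂ) :
    ketbra φ * ketbra χ = (star φ ⬝ᵥ χ) • vecMulVec φ (star χ) := by
  rw [ketbra, ketbra, vecMulVec_mul_vecMulVec, vecMulVec_smul]

lemma trace_ketbra_mul_ketbra (φ χ : κ → ℂ) :
    (ketbra φ * ketbra χ).trace = ((‖star φ ⬝ᵥ χ‖ ^ 2 : ℝ) : ℂ) := by
  rw [ketbra_mul_ketbra, trace_smul, trace_vecMulVec, ← star_mul_self_ofReal, smul_eq_mul,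
    mul_comm]
  congr 1
  rw [star_dotProduct, star_star, dotProduct_comm]

lemma ketbra_mul_self {φ : κ → ℂ} (hφ : IsUnitVec φ) : ketbra φ * ketbra φ = ketbra φ := by
  rw [ketbra_mul_ketbra, hφ, one_smul]; rfl
end

lemma posSemidef_traceQ {α β : Type} [Fintype β] {X : Matrix (α × β) (α × β) ℂ} (hX : X.PosSemidef) :
    (traceQ X).PosSemidef := by
  have : traceQ X = ∑ b, X.submatrix (fun a => (a, b)) (fun a => (a, b)) := by
    ext a a'; simp [traceQ, Matrix.sum_apply]
  rw [this]
  exact posSemidef_sum _ fun b _ => hX.submatrix _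

section
variable {α β : Type} [Fintype α] [Fintype β]

lemma trace_kronecker_one_mul [DecidableEq β] (Y : Matrix α α ℂ) (X : Matrix (α × β) (α × β) ℂ) :
    ((Y ⊗ₖ (1 : Matrix β β ℂ)) * X).trace = (Y * traceQ X).trace := by
  simp only [trace, diag_apply, mul_apply, Fintype.sum_prod_type, kroneckerMap_apply, traceQ,
    of_apply, one_apply, mul_ite, mul_one, mul_zero, ite_mul, zero_mul, Finset.sum_ite_eq,
    Finset.mem_univ, if_true, Finset.mul_sum]
  exact Finset.sum_congr rfl fun _ _ => Finset.sum_comm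

lemma traceQ_one_kronecker_mul_comm [DecidableEq α] (A : Matrix β β ℂ)
    (X : Matrix (α × β) (α × β) ℂ) :
    traceQ (((1 : Matrix α α ℂ) ⊗ₖ A) * X) = traceQ (X * ((1 : Matrix α α ℂ) ⊗ₖ A)) := by
  ext a a'
  simp only [mul_apply, Fintype.sum_prod_type, kroneckerMap_apply, traceQ,
    of_apply, one_apply, mul_ite, mul_zero, ite_mul, zero_mul, one_mul]
  have h1 : ∀ b, (∑ x, ∑ y, if a = x then A b y * X (x, y) (a', b) else 0) =
      ∑ y, A b y * X (a, y) (a', b) := fun b => by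
    rw [Finset.sum_comm]; simp
  have h2 : ∀ b, (∑ x, ∑ y, if x = a' then X (a, b) (x, y) * A y b else 0) =
      ∑ y, X (a, b) (a', y) * A y b := fun b => by
    rw [Finset.sum_comm]; simp
  simp only [h1, h2]
  rw [Finset.sum_comm]
  exact Finset.sum_congr rfl fun _ _ => Finset.sum_congr rfl fun _ _ => mul_comm _ _

lemma trace_traceQ (X : Matrix (α × β) (α × β) ℂ) : (traceQ X).trace = X.trace := by
  simp [trace, traceQ, Fintype.sum_prod_type]

/-- A positive operator with a pure marginal is a product. -/
lemma eq_ketbra_kronecker_of_traceQ [DecidableEq α] [DecidableEq β]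
    {X : Matrix (α × β) (α × β) ℂ}
    (hX : X.PosSemidef) {φ : α → ℂ} (hφ : IsUnitVec φ) {c : ℂ} (h : traceQ X = c • ketbra φ) :
    ∃ τ : Matrix β β ℂ, X = ketbra φ ⊗ₖ τ := by
  obtain ⟨L, rfl⟩ := hX.exists_eq_conjTranspose_mul_self
  set Y : Matrix α α ℂ := 1 - ketbra φ with hY
  set E : Matrix (α × β) (α × β) ℂ := Y ⊗ₖ (1 : Matrix β β ℂ) with hE
  have hYh : Yᴴ = Y := by rw [hY, conjTranspose_sub, conjTranspose_one, (isHermitian_ketbra φ).eq]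
  have hEh : Eᴴ = E := by rw [hE, conjTranspose_kronecker, hYh, conjTranspose_one]
  have hYY : Y * Y = Y := by
    rw [hY]; simp [sub_mul, mul_sub, ketbra_mul_self hφ]
  have hEE : E * E = E := by
    rw [hE, ← mul_kronecker_mul, hYY, Matrix.one_mul]
  -- `E` projects onto `φ^⊥ ⊗ Q`, and the weight of `X` there is the trace of its marginal against
  -- `1 - |φ⟩⟨φ|`, which vanishes.
  have hLE : L * E = 0 := by
    rw [← trace_conjTranspose_mul_self_eq_zero_iff, conjTranspose_mul, hEh]
    have : E * Lᴴ * (L * E) = E * (Lᴴ * L) * E := by simp only [Matrix.mul_assoc]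
    rw [this, trace_mul_comm, ← Matrix.mul_assoc, hEE, hE, trace_kronecker_one_mul, h, hY]
    simp [sub_mul, ketbra_mul_self hφ]
  have hXE : (Lᴴ * L) * E = 0 := by rw [Matrix.mul_assoc, hLE, Matrix.mul_zero]
  have hEX : E * (Lᴴ * L) = 0 := by
    have := congrArg conjTranspose hXE
    simpa [conjTranspose_mul, hEh] using this
  have hEe : E = 1 - ketbra φ ⊗ₖ (1 : Matrix β β ℂ) := by
    rw [hE, hY, ← one_kronecker_one]
    ext
    simp only [kroneckerMap_apply, Matrix.sub_apply, sub_mul]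
  generalize Lᴴ * L = X at hXE hEX
  rw [hEe, Matrix.mul_sub, Matrix.mul_one, sub_eq_zero] at hXE
  rw [hEe, Matrix.sub_mul, Matrix.one_mul, sub_eq_zero] at hEX
  -- The isometry `b ↦ φ ⊗ b`; its range projection fixes `X` on both sides.
  let Φ : Matrix (α × β) β ℂ := of fun m b => if m.2 = b then φ m.1 else 0
  have hΦ : ketbra φ ⊗ₖ (1 : Matrix β β ℂ) = Φ * Φᴴ := by
    ext ⟨a, b⟩ ⟨a', b'⟩
    rcases eq_or_ne b b' with rfl | hb
    · simp [Φ, mul_apply, ketbra, vecMulVec_apply, apply_ite]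
    · simp [Φ, mul_apply, ketbra, vecMulVec_apply, hb, apply_ite]
  refine ⟨Φᴴ * X * Φ, ?_⟩
  have h2 : X = Φ * (Φᴴ * X * Φ) * Φᴴ := by
    conv_lhs => rw [hEX, hXE, hΦ]
    simp only [Matrix.mul_assoc]
  conv_lhs => rw [h2]
  generalize Φᴴ * X * Φ = τ
  ext ⟨a, b⟩ ⟨a', b'⟩
  simp [Φ, mul_apply, ketbra, vecMulVec_apply, apply_ite]
  ring
end

/-! ### Rigidity of Naimark extensions of a SIC -/

section
variable {d : ℕ} {φ : Fin (d ^ 2) → Fin d → ℂ}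

lemma trace_ketbra_mul_ketbra_of_sic (hu : ∀ i, IsUnitVec (φ i))
    (ho : ∀ i j, i ≠ j → ‖star (φ j) ⬝ᵥ φ i‖ ^ 2 = 1 / ((d : ℝ) + 1)) (i j : Fin (d ^ 2)) :
    (ketbra (φ i) * ketbra (φ j)).trace =
      if i = j then 1 else 1 / ((d : ℂ) + 1) := by
  split_ifs with h
  · subst h; rw [ketbra_mul_self (hu i), trace_ketbra (hu i)]
  · rw [trace_ketbra_mul_ketbra, ho j i (Ne.symm h)]; push_cast; rfl

/-- The Gram matrix of the SIC projectors is `(d • 1 + J) / (d + 1)`, with `J` the all-ones matrix.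
-/
lemma trace_sum_smul_mul_ketbra (hu : ∀ i, IsUnitVec (φ i))
    (ho : ∀ i j, i ≠ j → ‖star (φ j) ⬝ᵥ φ i‖ ^ 2 = 1 / ((d : ℝ) + 1)) (c : Fin (d ^ 2) → ℂ)
    (j : Fin (d ^ 2)) :
    ((∑ i, c i • ketbra (φ i)) * ketbra (φ j)).trace = (d * c j + ∑ i, c i) / (d + 1) := by
  have hd : (d : ℂ) + 1 ≠ 0 := by exact_mod_cast Nat.succ_ne_zero d
  have h1 : ∀ i, c i * (if i = j then (1 : ℂ) else 1 / ((d : ℂ) + 1)) =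
      (if i = j then c i * (d / (d + 1)) else 0) + c i / (d + 1) := fun i => by
    split_ifs
    · field_simp
    · simp [div_eq_mul_inv]
  simp only [Finset.sum_mul, trace_sum, smul_mul_assoc, trace_smul,
    trace_ketbra_mul_ketbra_of_sic hu ho, smul_eq_mul, h1, Finset.sum_add_distrib,
    Finset.sum_ite_eq', Finset.mem_univ, if_true, ← Finset.sum_div]
  field_simp

/-- Taking the trace gives `∑ c = 0`; pairing with the `j`-th projector then leaves `d * c j / (d +
1) = 0`. -/
lemma eq_zero_of_sum_smul_ketbra_eq_zero (hd : d ≠ 0) (hu : ∀ i, IsUnitVec (φ i))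
    (ho : ∀ i j, i ≠ j → ‖star (φ j) ⬝ᵥ φ i‖ ^ 2 = 1 / ((d : ℝ) + 1)) {c : Fin (d ^ 2) → ℂ}
    (h : ∑ i, c i • ketbra (φ i) = 0) (j : Fin (d ^ 2)) : c j = 0 := by
  have hd' : (d : ℂ) + 1 ≠ 0 := by exact_mod_cast Nat.succ_ne_zero d
  have h0 : ∑ i, c i = 0 := by
    have := congrArg trace h
    simpa [trace_sum, trace_smul, trace_ketbra (hu _)] using this
  have h1 := trace_sum_smul_mul_ketbra hu ho c j
  rw [h, h0, Matrix.zero_mul, trace_zero, add_zero, eq_comm, div_eq_zero_iff] at h1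
  simpa [hd, hd'] using h1

/-- For a SIC, the ancilla cannot be correlated with the outcome. -/
lemma naimark_compress {M : Fin (d ^ 2) → Matrix (Fin d) (Fin d) ℂ} (hd : d ≠ 0)
    (hM : IsSIC M) {n : ℕ} {P : Fin (d ^ 2) → Matrix (Fin d × Fin n) (Fin d × Fin n) ℂ}
    {A : Matrix (Fin n) (Fin n) ℂ} (h : IsNaimarkExt M P (A * Aᴴ)) (i : Fin (d ^ 2)) :
    ((1 : Matrix (Fin d) (Fin d) ℂ) ⊗ₖ Aᴴ) * P i * ((1 : Matrix (Fin d) (Fin d) ℂ) ⊗ₖ A) =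
      M i ⊗ₖ (Aᴴ * A) := by
  obtain ⟨⟨-, hsum⟩, φ, hu, ho, hφ⟩ := hM
  obtain ⟨hP, -, hN⟩ := h
  have hd0 : (d : ℂ) ≠ 0 := by exact_mod_cast hd
  set T : Matrix (Fin d × Fin n) (Fin d × Fin n) ℂ := (1 : Matrix (Fin d) (Fin d) ℂ) ⊗ₖ A with hT
  have hTh : (1 : Matrix (Fin d) (Fin d) ℂ) ⊗ₖ Aᴴ = Tᴴ := by
    rw [hT, conjTranspose_kronecker, conjTranspose_one]
  have htr : ∀ i, traceQ (Tᴴ * P i * T) = (1 / (d : ℂ)) • ketbra (φ i) := fun i => by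
    rw [← hφ, hN, Matrix.mul_assoc, ← hTh, traceQ_one_kronecker_mul_comm, Matrix.mul_assoc, hT,
      ← mul_kronecker_mul, Matrix.mul_one]
  have hpos : ∀ i, (Tᴴ * P i * T).PosSemidef := fun i => by
    have : Tᴴ * P i * T = (P i * T)ᴴ * (P i * T) := by
      rw [conjTranspose_mul, (hP.1 i).1.eq, Matrix.mul_assoc, Matrix.mul_assoc,
        ← Matrix.mul_assoc (P i) (P i), (hP.1 i).2]
    rw [this]; exact posSemidef_conjTranspose_mul_self _
  choose τ hτ using fun i => eq_ketbra_kronecker_of_traceQ (hpos i) (hu i) (htr i)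
  have hs : ∑ i, ketbra (φ i) ⊗ₖ τ i = (1 : Matrix (Fin d) (Fin d) ℂ) ⊗ₖ (Aᴴ * A) := by
    simp only [← hτ]
    rw [← Finset.sum_mul, ← Finset.mul_sum, hP.2.2, Matrix.mul_one, ← hTh, hT,
      ← mul_kronecker_mul, Matrix.mul_one]
  have hτe : ∀ i, τ i = (1 / (d : ℂ)) • (Aᴴ * A) := fun i => by
    ext b b'
    -- Linear independence is applied separately to each ancilla matrix entry.
    have h0 : ∑ i, (τ i b b' - (1 / (d : ℂ)) * (Aᴴ * A) b b') • ketbra (φ i) = 0 := by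
      simp only [sub_smul, Finset.sum_sub_distrib, mul_comm (1 / (d : ℂ)), mul_smul, ← hφ]
      rw [← Finset.smul_sum, hsum, sub_eq_zero]
      ext a a'
      have := congrFun (congrFun hs (a, b)) (a', b')
      simp only [Matrix.sum_apply, kroneckerMap_apply] at this
      simp only [Matrix.sum_apply, Matrix.smul_apply, smul_eq_mul]
      rw [mul_comm ((Aᴴ * A) b b'), ← this]
      exact Finset.sum_congr rfl fun _ _ => mul_comm _ _
    have := eq_zero_of_sum_smul_ketbra_eq_zero hd hu ho h0 i
    simpa [sub_eq_zero] using this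
  rw [hTh, hτ, hτe, hφ, kronecker_smul, smul_kronecker]
end

/-! ### Outcome distributions and the value of `R_q` -/

/-- The probability of outcome `i` of the measurement `M` on the state `ρ`. -/
def bornProb {ι κ : Type} [Fintype κ] (M : ι → Matrix κ κ ℂ) (ρ : Matrix κ κ ℂ) (i : ι) : ℝ :=
  (M i * ρ).trace.re

section
variable {ι κ : Type} [Fintype ι] [Fintype κ] [DecidableEq κ]

lemma vnEntropy_blockDiagonal_smul [DecidableEq ι] {ν : Type} [Fintype ν] [DecidableEq ν]
    {σ : Matrix ν ν ℂ} (hσ : σ.IsHermitian) (hσ1 : σ.trace = 1)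
    {p : ι → ℝ} (hp : ∑ i, p i = 1) :
    vnEntropy (blockDiagonal fun i => (p i : ℂ) • σ) = vnEntropy σ + ∑ i, entropyTerm (p i) := by
  have h : (blockDiagonal fun i => (p i : ℂ) • σ) = σ ⊗ₖ diagonal (fun i => (p i : ℂ)) := by
    rw [kronecker_diagonal]; simp
  have hD : (diagonal (fun i => (p i : ℂ))).IsHermitian := by
    rw [isHermitian_diagonal_iff]; intro i; simp [IsSelfAdjoint]
  rw [h, vnEntropy_kronecker hσ hD, vnEntropy_diagonal, hσ1, trace_diagonal, Complex.re_sum]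
  simp [hp]

lemma vnEntropy_one_unit : vnEntropy (1 : Matrix Unit Unit ℂ) = 0 := by
  have := vnEntropy_diagonal (fun _ : Unit => (1 : ℝ))
  simpa [entropyTerm] using this

lemma bornProb_nonneg {M : ι → Matrix κ κ ℂ} (hM : IsPOVM M) {ρ : Matrix κ κ ℂ}
    (hρ : ρ.PosSemidef) (i : ι) :
    0 ≤ bornProb M ρ i ∧ (M i * ρ).trace = bornProb M ρ i := by
  obtain ⟨L, rfl⟩ := hρ.exists_eq_conjTranspose_mul_self
  have h : (0 : ℂ) ≤ (M i * (Lᴴ * L)).trace := by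
    rw [← Matrix.mul_assoc, trace_mul_comm, ← Matrix.mul_assoc]
    exact ((hM.1 i).mul_mul_conjTranspose_same L).trace_nonneg
  rw [Complex.nonneg_iff] at h
  exact ⟨h.1, Complex.ext (by simp [bornProb]) (by simp [← h.2])⟩

lemma sum_bornProb {M : ι → Matrix κ κ ℂ} (hM : IsPOVM M) {ρ : Matrix κ κ ℂ}
    (hρ : ρ.trace = 1) : ∑ i, bornProb M ρ i = 1 := by
  simp only [bornProb]
  rw [← Complex.re_sum, ← trace_sum, ← Finset.sum_mul, hM.2, Matrix.one_mul, hρ, Complex.one_re]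

lemma vnEntropy_dephase_ketbra [DecidableEq ι] {P : ι → Matrix κ κ ℂ} (hP : IsPVM P) {ψ : κ → ℂ} {p : ι → ℝ}
    (hp : ∑ i, p i = 1) (h : ∀ i, star ψ ⬝ᵥ P i *ᵥ ψ = p i) :
    vnEntropy (dephase P (ketbra ψ)) = ∑ i, entropyTerm (p i) := by
  rw [ketbra_eq_replicateCol, vnEntropy_dephase hP]
  have : ∀ i, (replicateCol Unit ψ)ᴴ * P i * replicateCol Unit ψ =
      (p i : ℂ) • (1 : Matrix Unit Unit ℂ) := fun i => by
    ext
    rw [← h, conjTranspose_replicateCol, Matrix.mul_assoc, ← replicateCol_mulVec]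
    simp [mul_apply, dotProduct]
  simp only [this]
  rw [vnEntropy_blockDiagonal_smul isHermitian_one (by simp) hp, vnEntropy_one_unit, zero_add]
end

/-- For a SIC, `R_q(ρ ⊗ σ, P) = H(p) - S(ρ)` for every generalized Naimark extension. -/
lemma pvmRandQ_naimark {d : ℕ} {M : Fin (d ^ 2) → Matrix (Fin d) (Fin d) ℂ} (hd : d ≠ 0)
    (hM : IsSIC M) {n : ℕ} {P : Fin (d ^ 2) → Matrix (Fin d × Fin n) (Fin d × Fin n) ℂ}
    {σ : Matrix (Fin n) (Fin n) ℂ} (h : IsNaimarkExt M P σ) {ρ : Matrix (Fin d) (Fin d) ℂ}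
    (hρ : IsState ρ) :
    pvmRandQ (ρ ⊗ₖ σ) P = ∑ i, entropyTerm (bornProb M ρ i) - vnEntropy ρ := by
  have hσ := h.2.1
  rw [pvmRandQ_eq h.1, vnEntropy_kronecker hρ.1.1 hσ.1.1, hσ.2, hρ.2]
  suffices vnEntropy (dephase P (ρ ⊗ₖ σ)) =
      vnEntropy σ + ∑ i, entropyTerm (bornProb M ρ i) by
    rw [this]; simp only [Complex.one_re]; ring
  obtain ⟨A, hA⟩ := hσ.1.exists_eq_mul_conjTranspose_self
  obtain ⟨R, hR⟩ := hρ.1.exists_eq_mul_conjTranspose_self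
  have hX := naimark_compress hd hM (hA ▸ h)
  obtain ⟨hMP, φ, hu, ho, hφ⟩ := hM
  -- Chosen so that `w wᴴ = Rᴴ * M i * R`, whose trace is the outcome probability.
  let w : Fin (d ^ 2) → Fin d → ℂ := fun i => ((1 / Real.sqrt d : ℝ) : ℂ) • Rᴴ *ᵥ φ i
  have hw : ∀ i, replicateCol Unit (w i) * (replicateCol Unit (w i))ᴴ = Rᴴ * M i * R := fun i => by
    have hs : ((1 / Real.sqrt d : ℝ) : ℂ) * ((1 / Real.sqrt d : ℝ) : ℂ) = 1 / (d : ℂ) := by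
      rw [← Complex.ofReal_mul, div_mul_div_comm, Real.mul_self_sqrt (Nat.cast_nonneg d)]
      simp
    simp only [w]
    rw [hφ, ketbra_eq_replicateCol, replicateCol_smul, replicateCol_mulVec, conjTranspose_smul,
      Matrix.smul_mul, Matrix.mul_smul, smul_smul, conjTranspose_mul, conjTranspose_conjTranspose, Complex.star_def,
      Complex.conj_ofReal, hs, Matrix.mul_smul, Matrix.smul_mul]
    simp only [Matrix.mul_assoc]
  have hw' : ∀ i, (replicateCol Unit (w i))ᴴ * replicateCol Unit (w i) =
      (bornProb M ρ i : ℂ) • (1 : Matrix Unit Unit ℂ) := fun i => by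
    have ht : ((replicateCol Unit (w i))ᴴ * replicateCol Unit (w i)).trace = bornProb M ρ i := by
      rw [trace_mul_comm, hw, Matrix.mul_assoc, trace_mul_comm, Matrix.mul_assoc, ← hR]
      exact (bornProb_nonneg hMP hρ.1 i).2
    ext
    simpa [trace] using ht
  let C : Fin (d ^ 2) → Matrix (Fin d × Fin n) (Unit × Fin n) ℂ :=
    fun i => replicateCol Unit (w i) ⊗ₖ Aᴴ
  have hS : ρ ⊗ₖ σ = (R ⊗ₖ A) * (R ⊗ₖ A)ᴴ := by
    rw [conjTranspose_kronecker, ← mul_kronecker_mul, ← hA, ← hR]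
  have hC : ∀ i, (R ⊗ₖ A)ᴴ * P i * (R ⊗ₖ A) = C i * (C i)ᴴ := fun i => by
    have e : R ⊗ₖ A = ((1 : Matrix (Fin d) (Fin d) ℂ) ⊗ₖ A) *
        (R ⊗ₖ (1 : Matrix (Fin n) (Fin n) ℂ)) := by
      rw [← mul_kronecker_mul, Matrix.one_mul, Matrix.mul_one]
    have e' : (R ⊗ₖ A)ᴴ * P i * (R ⊗ₖ A) = (Rᴴ ⊗ₖ (1 : Matrix (Fin n) (Fin n) ℂ)) *
        (((1 : Matrix (Fin d) (Fin d) ℂ) ⊗ₖ Aᴴ) * P i * ((1 : Matrix (Fin d) (Fin d) ℂ) ⊗ₖ A)) *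
        (R ⊗ₖ (1 : Matrix (Fin n) (Fin n) ℂ)) := by
      rw [e, conjTranspose_mul, conjTranspose_kronecker, conjTranspose_kronecker,
        conjTranspose_one, conjTranspose_one]
      simp only [Matrix.mul_assoc]
    rw [e', hX, ← mul_kronecker_mul, ← mul_kronecker_mul, Matrix.one_mul, Matrix.mul_one]
    simp only [C]
    rw [conjTranspose_kronecker, ← mul_kronecker_mul, hw, conjTranspose_conjTranspose]
  have hC' : ∀ i, (C i)ᴴ * C i = (bornProb M ρ i : ℂ) • ((1 : Matrix Unit Unit ℂ) ⊗ₖ σ) :=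
    fun i => by
      simp only [C]
      rw [conjTranspose_kronecker, ← mul_kronecker_mul, hw', conjTranspose_conjTranspose, ← hA,
        smul_kronecker]
  have hσ' : ((1 : Matrix Unit Unit ℂ) ⊗ₖ σ).IsHermitian := by
    rw [IsHermitian, conjTranspose_kronecker, conjTranspose_one, hσ.1.1.eq]
  rw [hS, vnEntropy_dephase h.1]
  simp only [hC]
  -- Swapping the factors of each block replaces the rank-one part by the number `p i` and `Aᴴ * A`
  -- by `σ`.
  rw [vnEntropy_blockDiagonal_mul_conjTranspose_self]
  simp only [hC']
  rw [vnEntropy_blockDiagonal_smul hσ' (by rw [trace_kronecker, hσ.2]; simp)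
    (sum_bornProb hMP hρ.2), vnEntropy_kronecker isHermitian_one hσ.1.1, vnEntropy_one_unit]
  simp

/-! ### Vectors occurring in decompositions of `ρ ⊗ σ` -/

/-- A Hermitian matrix has a Hermitian generalized inverse. -/
lemma Matrix.IsHermitian.exists_hermitian_generalized_inverse {κ : Type} [Fintype κ] [DecidableEq κ]
    {σ : Matrix κ κ ℂ} (hσ : σ.IsHermitian) :
    ∃ τ : Matrix κ κ ℂ, τᴴ = τ ∧ σ * τ * σ = σ := by
  have hs : IsSelfAdjoint σ := hσ
  have hf : (spectrum ℝ σ).Finite := finite_real_spectrum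
  -- Since `0⁻¹ = 0`, the identity `x * x⁻¹ * x = x` holds on the whole spectrum.
  refine ⟨cfc (fun x : ℝ => x⁻¹) σ, ?_, ?_⟩
  · exact (cfc_predicate (R := ℝ) (p := IsSelfAdjoint) (fun x : ℝ => x⁻¹) σ)
  · calc σ * cfc (fun x : ℝ => x⁻¹) σ * σ
        = cfc (fun x : ℝ => x) σ * cfc (fun x : ℝ => x⁻¹) σ * cfc (fun x : ℝ => x) σ := by
          rw [cfc_id' ℝ σ]
      _ = cfc (fun x : ℝ => x * x⁻¹ * x) σ := by
          rw [← cfc_mul _ _ σ (hf.continuousOn _) (hf.continuousOn _),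
            ← cfc_mul _ _ σ (hf.continuousOn _) (hf.continuousOn _)]
      _ = cfc (fun x : ℝ => x) σ := by simp
      _ = σ := cfc_id' ℝ σ

/-- Between two factors `1 ⊗ σ`, `P i` may be replaced by `M i ⊗ 1`, by `naimark_compress`. -/
lemma star_dotProduct_mulVec_naimark {d : ℕ} {M : Fin (d ^ 2) → Matrix (Fin d) (Fin d) ℂ}
    (hd : d ≠ 0) (hM : IsSIC M) {n : ℕ}
    {P : Fin (d ^ 2) → Matrix (Fin d × Fin n) (Fin d × Fin n) ℂ}
    {σ : Matrix (Fin n) (Fin n) ℂ} (h : IsNaimarkExt M P σ) {ψ χ : Fin d × Fin n → ℂ}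
    (hψ : ψ = ((1 : Matrix (Fin d) (Fin d) ℂ) ⊗ₖ σ) *ᵥ χ) (i : Fin (d ^ 2)) :
    star ψ ⬝ᵥ P i *ᵥ ψ = bornProb M (traceQ (ketbra ψ)) i := by
  have hσ := h.2.1
  rw [← (bornProb_nonneg hM.1 (posSemidef_traceQ (posSemidef_ketbra ψ)) i).2,
    ← trace_kronecker_one_mul, trace_mul_ketbra]
  obtain ⟨A, hA⟩ := hσ.1.exists_eq_mul_conjTranspose_self
  have hX := naimark_compress hd hM (hA ▸ h) i
  set I : Matrix (Fin d) (Fin d) ℂ := 1 with hI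
  have key : (I ⊗ₖ σ) * P i * (I ⊗ₖ σ) = (I ⊗ₖ σ) * (M i ⊗ₖ 1) * (I ⊗ₖ σ) := by
    have e : I ⊗ₖ σ = (I ⊗ₖ A) * (I ⊗ₖ Aᴴ) := by
      rw [← mul_kronecker_mul, ← hA, hI, Matrix.one_mul]
    calc (I ⊗ₖ σ) * P i * (I ⊗ₖ σ)
        = (I ⊗ₖ A) * ((I ⊗ₖ Aᴴ) * P i * (I ⊗ₖ A)) * (I ⊗ₖ Aᴴ) := by
          rw [e]; simp only [Matrix.mul_assoc]
      _ = _ := by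
          rw [hX, ← mul_kronecker_mul, ← mul_kronecker_mul, ← mul_kronecker_mul,
            ← mul_kronecker_mul, hA]
          simp only [Matrix.mul_assoc, Matrix.one_mul, Matrix.mul_one, hI]
  have hS : (I ⊗ₖ σ)ᴴ = I ⊗ₖ σ := by
    rw [conjTranspose_kronecker, hI, conjTranspose_one, hσ.1.1.eq]
  have hq : ∀ Y : Matrix (Fin d × Fin n) (Fin d × Fin n) ℂ,
      star ψ ⬝ᵥ Y *ᵥ ψ = star χ ⬝ᵥ ((I ⊗ₖ σ) * Y * (I ⊗ₖ σ)) *ᵥ χ := fun Y => by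
    rw [hψ, star_mulVec, hS, ← dotProduct_mulVec, mulVec_mulVec, mulVec_mulVec]
  rw [hq, hq, key]

/-- A vector in a pure-state decomposition of `ρ ⊗ σ` lies in the range of `1 ⊗ σ`. -/
lemma mem_range_of_decomposition {d n k : ℕ} {ρ : Matrix (Fin d) (Fin d) ℂ}
    {σ : Matrix (Fin n) (Fin n) ℂ} (hσ : σ.IsHermitian) {q : Fin k → ℝ}
    {ψ : Fin k → Fin d × Fin n → ℂ} (hq : ∀ j, 0 ≤ q j)
    (h : ρ ⊗ₖ σ = ∑ j, (q j : ℂ) • ketbra (ψ j)) {j : Fin k} (hj : q j ≠ 0) :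
    ∃ χ, ψ j = ((1 : Matrix (Fin d) (Fin d) ℂ) ⊗ₖ σ) *ᵥ χ := by
  obtain ⟨τ, hτ, hστ⟩ := hσ.exists_hermitian_generalized_inverse
  have hker : ∀ v, (ρ ⊗ₖ σ) *ᵥ v = 0 → star v ⬝ᵥ ψ j = 0 := fun v hv => by
    have h0 : ∑ j, (q j : ℂ) * ((‖star v ⬝ᵥ ψ j‖ ^ 2 : ℝ) : ℂ) = 0 := by
      have h1 : star v ⬝ᵥ (ρ ⊗ₖ σ) *ᵥ v = 0 := by rw [hv, dotProduct_zero]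
      rw [← trace_mul_ketbra, h, Finset.sum_mul, trace_sum] at h1
      rw [← h1]
      refine Finset.sum_congr rfl fun j _ => ?_
      rw [smul_mul_assoc, trace_smul, trace_mul_comm, trace_ketbra_mul_ketbra, smul_eq_mul]
    have h2 : ∑ j, q j * ‖star v ⬝ᵥ ψ j‖ ^ 2 = 0 := by exact_mod_cast h0
    have h3 := (Finset.sum_eq_zero_iff_of_nonneg
      (fun j _ => mul_nonneg (hq j) (sq_nonneg _))).1 h2 j (Finset.mem_univ j)
    simpa [hj] using h3
  refine ⟨((1 : Matrix (Fin d) (Fin d) ℂ) ⊗ₖ τ) *ᵥ ψ j, ?_⟩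
  set I : Matrix (Fin d) (Fin d) ℂ := 1 with hI
  -- The columns of `1 - 1 ⊗ τσ` lie in the kernel because `στσ = σ`; orthogonality to them says `ψ
  -- j = (1 ⊗ στ) ψ j`.
  have hE : ∀ m, star ((1 - I ⊗ₖ (τ * σ)) *ᵥ Pi.single m 1) ⬝ᵥ ψ j = 0 := fun m => by
    apply hker
    rw [mulVec_mulVec, Matrix.mul_sub, ← mul_kronecker_mul, ← Matrix.mul_assoc, hστ, hI]
    simp only [Matrix.mul_one, sub_self, zero_mulVec]
  have hz : (1 - I ⊗ₖ (τ * σ))ᴴ *ᵥ ψ j = 0 := by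
    ext m
    have := hE m
    rw [star_mulVec, ← dotProduct_mulVec] at this
    simpa [← Pi.single_star] using this
  rw [conjTranspose_sub, conjTranspose_one, conjTranspose_kronecker, conjTranspose_mul, hτ,
    hσ.eq, hI, conjTranspose_one, sub_mulVec, one_mulVec, sub_eq_zero] at hz
  rw [mulVec_mulVec, ← mul_kronecker_mul, hI, Matrix.one_mul]
  exact hz

lemma IsUnitVec.isState_traceQ {d n : ℕ} {ψ : Fin d × Fin n → ℂ} (hψ : IsUnitVec ψ) :
    IsState (traceQ (ketbra ψ)) :=
  ⟨posSemidef_traceQ (posSemidef_ketbra ψ), by rw [trace_traceQ, trace_ketbra hψ]⟩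

/-! ### Entropy and purity bounds -/

/-- Shannon entropy is at least the collision entropy. -/
lemma neg_logb_sum_sq_le {ι : Type} [Fintype ι] {p : ι → ℝ} (hp0 : ∀ i, 0 ≤ p i)
    (hp : ∑ i, p i = 1) {s : ℝ} (hs : ∑ i, p i ^ 2 ≤ s) (hs0 : 0 < s) :
    -Real.log s / Real.log 2 ≤ ∑ i, entropyTerm (p i) := by
  have hl : 0 < Real.log 2 := Real.log_pos one_lt_two
  simp only [entropyTerm, ← Finset.sum_div]
  rw [div_le_div_iff_of_pos_right hl]
  -- This is `log u ≤ u - 1` at `u = p i / s`, multiplied by `p i`.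
  have h : ∀ i, -(p i * Real.log s) - p i ^ 2 / s + p i ≤ Real.negMulLog (p i) := fun i => by
    rcases (hp0 i).eq_or_lt with h0 | h0
    · simp [← h0]
    · have h1 := Real.log_le_sub_one_of_pos (div_pos h0 hs0)
      rw [Real.log_div h0.ne' hs0.ne'] at h1
      have h2 := mul_le_mul_of_nonneg_left h1 h0.le
      have h3 : p i * (p i / s - 1) = p i ^ 2 / s - p i := by ring
      rw [Real.negMulLog]
      linarith
  have := Finset.sum_le_sum fun i (_ : i ∈ Finset.univ) => h i
  rw [Finset.sum_add_distrib, Finset.sum_sub_distrib, Finset.sum_neg_distrib, ← Finset.sum_mul, hp,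
    ← Finset.sum_div] at this
  have h4 : (∑ i, p i ^ 2) / s ≤ 1 := (div_le_one hs0).2 hs
  linarith

lemma sum_negMulLog_le_log_card {d : ℕ} (hd : d ≠ 0) {x : Fin d → ℝ}
    (hx : x ∈ stdSimplex ℝ (Fin d)) : ∑ i, Real.negMulLog (x i) ≤ Real.log d := by
  have hd0 : (0 : ℝ) < d := by positivity
  have h : ∀ i, Real.negMulLog (x i) ≤ x i * Real.log d + 1 / d - x i := fun i => by
    rcases (hx.1 i).eq_or_lt with h0 | h0
    · simp [← h0]
    · have h1 := Real.log_le_sub_one_of_pos (inv_pos.2 (mul_pos hd0 h0))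
      rw [Real.log_inv, Real.log_mul hd0.ne' h0.ne'] at h1
      have h2 := mul_le_mul_of_nonneg_left h1 h0.le
      have h3 : x i * ((d * x i)⁻¹ - 1) = 1 / d - x i := by field_simp
      rw [Real.negMulLog]
      linarith
  refine (Finset.sum_le_sum fun i _ => h i).trans_eq ?_
  rw [Finset.sum_sub_distrib, Finset.sum_add_distrib, ← Finset.sum_mul, hx.2]
  simp [hd0.ne']

/-- Entropy plus the logarithm of one plus the purity stays away from `log (2 d)`. -/
lemma exists_bound_entropy_add_log_purity {d : ℕ} (hd : 2 ≤ d) :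
    ∃ c < Real.log (2 * d), ∀ x ∈ stdSimplex ℝ (Fin d),
      ∑ i, Real.negMulLog (x i) + Real.log (1 + ∑ i, x i ^ 2) ≤ c := by
  have hpos : ∀ x : Fin d → ℝ, 0 < 1 + ∑ i, x i ^ 2 := fun x => by positivity
  have hne : (stdSimplex ℝ (Fin d)).Nonempty :=
    ⟨_, single_mem_stdSimplex ℝ (⟨0, by omega⟩ : Fin d)⟩
  have hcont : Continuous fun x : Fin d → ℝ =>
      ∑ i, Real.negMulLog (x i) + Real.log (1 + ∑ i, x i ^ 2) := by
    refine (continuous_finsetSum _ fun i _ =>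
      Real.continuous_negMulLog.comp (continuous_apply i)).add ?_
    exact Continuous.log (by fun_prop) fun x => (hpos x).ne'
  obtain ⟨x, hx, hmax⟩ := (isCompact_stdSimplex ℝ (Fin d)).exists_isMaxOn hne hcont.continuousOn
  refine ⟨_, ?_, fun y hy => hmax hy⟩
  have hd1 : (1 : ℝ) < d := by exact_mod_cast hd
  rw [Real.log_mul two_ne_zero (by positivity)]
  have hle1 : ∀ i, x i ≤ 1 := fun i => by
    rw [← hx.2]; exact Finset.single_le_sum (fun j _ => hx.1 j) (Finset.mem_univ i)
  have hsq : ∀ i, x i ^ 2 ≤ x i := fun i => by nlinarith [hx.1 i, hle1 i]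
  have ht : ∑ i, x i ^ 2 ≤ 1 := hx.2 ▸ Finset.sum_le_sum fun i _ => hsq i
  have hS := sum_negMulLog_le_log_card (by omega) hx
  -- At the maximizer, purity below one makes the `log 2` bound strict; purity one forces entries in
  -- `{0, 1}`, so the entropy is zero and `1 < d` gives the gap.
  rcases ht.lt_or_eq with h | h
  · have := Real.log_lt_log (hpos x) (show 1 + ∑ i, x i ^ 2 < 2 by linarith)
    linarith
  · have h0 : ∀ i, x i ^ 2 = x i := fun i =>
      (Finset.sum_eq_sum_iff_of_le fun i _ => hsq i).1 (h.trans hx.2.symm) i (Finset.mem_univ i)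
    have hS0 : ∑ i, Real.negMulLog (x i) = 0 := Finset.sum_eq_zero fun i _ => by
      have h2 : x i = 0 ∨ x i = 1 := by
        have : x i * (x i - 1) = 0 := by linarith [h0 i]
        rcases mul_eq_zero.1 this with h | h
        · exact Or.inl h
        · exact Or.inr (by linarith)
      rcases h2 with h | h <;> simp [h]
    beta_reduce
    rw [hS0, h, show (1 : ℝ) + 1 = 2 by norm_num]
    linarith [Real.log_pos hd1]

lemma IsState.sum_eigenvalues {κ : Type} [Fintype κ] [DecidableEq κ] {ρ : Matrix κ κ ℂ}
    (hρ : IsState ρ) : ∑ i, hρ.1.1.eigenvalues i = 1 := by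
  have := hρ.1.1.trace_eq_sum_eigenvalues.symm.trans hρ.2
  rw [← RCLike.ofReal_sum] at this
  exact Complex.ofReal_injective (this.trans Complex.ofReal_one.symm)

section
variable {d : ℕ} {M : Fin (d ^ 2) → Matrix (Fin d) (Fin d) ℂ} {ρ : Matrix (Fin d) (Fin d) ℂ}

lemma IsState.eigenvalues_mem_stdSimplex (hρ : IsState ρ) :
    hρ.1.1.eigenvalues ∈ stdSimplex ℝ (Fin d) :=
  ⟨hρ.1.eigenvalues_nonneg, hρ.sum_eigenvalues⟩

lemma Matrix.IsHermitian.trace_mul_self_eq_sum_eigenvalues_sq (hρ : ρ.IsHermitian) :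
    (ρ * ρ).trace = ((∑ i, hρ.eigenvalues i ^ 2 : ℝ) : ℂ) := by
  obtain ⟨W, hW, h⟩ := hρ.eq_conj_diagonal
  set D := diagonal (fun i => (hρ.eigenvalues i : ℂ)) with hD
  have e : ρ * ρ = W * (D * D) * Wᴴ := by
    conv_lhs => rw [h]
    calc W * D * Wᴴ * (W * D * Wᴴ) = W * D * (Wᴴ * W) * (D * Wᴴ) := by
          simp only [Matrix.mul_assoc]
      _ = _ := by rw [hW]; simp only [Matrix.mul_assoc, Matrix.one_mul]
  rw [e, trace_mul_comm, ← Matrix.mul_assoc, hW, Matrix.one_mul, hD, diagonal_mul_diagonal,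
    trace_diagonal]
  push_cast
  exact Finset.sum_congr rfl fun _ _ => (sq _).symm

/-- Linear inversion of the outcome statistics gives an operator `Y` with `tr (Y * ρ) = tr (Y * Y) =
d(d+1) ∑ p² - 1`. Then `tr (ρ - Y)² ≥ 0` is the claim, without needing `Y = ρ`. -/
lemma sum_bornProb_sq_le (hd : d ≠ 0) (hM : IsSIC M) (hρ : IsState ρ) :
    ∑ i, bornProb M ρ i ^ 2 ≤
      (1 + ∑ i, hρ.1.1.eigenvalues i ^ 2) / (d * (d + 1)) := by
  obtain ⟨hP, φ, hu, ho, hφ⟩ := hM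
  have hd0 : (d : ℝ) ≠ 0 := by exact_mod_cast hd
  have hd0' : (d : ℂ) ≠ 0 := by exact_mod_cast hd
  have hd1 : (d : ℂ) + 1 ≠ 0 := by exact_mod_cast Nat.succ_ne_zero d
  set p := bornProb M ρ with hp
  have hp1 : ∑ i, p i = 1 := sum_bornProb hP hρ.2
  have hpφ : ∀ i, (ketbra (φ i) * ρ).trace = d * p i := fun i => by
    have := (bornProb_nonneg hP hρ.1 i).2
    rw [hφ, smul_mul_assoc, trace_smul, smul_eq_mul] at this
    rw [hp, ← this]; field_simp
  -- Solves `(d * r j + ∑ r) / (d + 1) = d * p j` with `∑ r = 1`.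
  let r : Fin (d ^ 2) → ℝ := fun j => (d + 1) * p j - 1 / d
  have hr1 : ∑ j, r j = 1 := by
    simp only [r, Finset.sum_sub_distrib, ← Finset.mul_sum, hp1]
    simp; field_simp; ring
  set Y : Matrix (Fin d) (Fin d) ℂ := ∑ j, (r j : ℂ) • ketbra (φ j) with hY
  have hYφ : ∀ j, (Y * ketbra (φ j)).trace = d * p j := fun j => by
    rw [hY, trace_sum_smul_mul_ketbra hu ho]
    have : ∑ i, (r i : ℂ) = 1 := by exact_mod_cast hr1
    rw [this]
    simp only [r]
    push_cast
    field_simp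
    ring
  have hYh : Yᴴ = Y := by
    rw [hY, conjTranspose_sum]
    refine Finset.sum_congr rfl fun j _ => ?_
    rw [conjTranspose_smul, (isHermitian_ketbra _).eq, Complex.star_def, Complex.conj_ofReal]
  have hYY : (Y * Y).trace = ((∑ j, r j * (d * p j) : ℝ) : ℂ) := by
    conv_lhs => rw [hY, ← hY, show Y * Y = Y * ∑ j, (r j : ℂ) • ketbra (φ j) by rw [← hY]]
    rw [Finset.mul_sum, trace_sum]
    push_cast
    refine Finset.sum_congr rfl fun j _ => ?_
    rw [Matrix.mul_smul, trace_smul, hYφ, smul_eq_mul]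
  have hYρ : (Y * ρ).trace = ((∑ j, r j * (d * p j) : ℝ) : ℂ) := by
    rw [hY, Finset.sum_mul, trace_sum]
    push_cast
    refine Finset.sum_congr rfl fun j _ => ?_
    rw [smul_mul_assoc, trace_smul, hpφ, smul_eq_mul]
  have hpos : (0 : ℂ) ≤ ((ρ - Y)ᴴ * (ρ - Y)).trace :=
    (posSemidef_conjTranspose_mul_self _).trace_nonneg
  have hexp : ((ρ - Y)ᴴ * (ρ - Y)).trace =
      ((∑ i, hρ.1.1.eigenvalues i ^ 2 - ∑ j, r j * (d * p j) : ℝ) : ℂ) := by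
    rw [conjTranspose_sub, hρ.1.1.eq, hYh, Matrix.sub_mul, Matrix.mul_sub, Matrix.mul_sub,
      trace_sub, trace_sub, trace_sub, trace_mul_comm ρ Y, hYρ, hYY,
      hρ.1.1.trace_mul_self_eq_sum_eigenvalues_sq]
    push_cast
    ring
  rw [hexp] at hpos
  have hpos' : 0 ≤ ∑ i, hρ.1.1.eigenvalues i ^ 2 - ∑ j, r j * (d * p j) := by
    exact_mod_cast hpos
  have hrp : ∑ j, r j * (d * p j) = d * (d + 1) * ∑ j, p j ^ 2 - 1 := by
    have : ∀ j, r j * (d * p j) = d * (d + 1) * p j ^ 2 - p j := fun j => by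
      simp only [r]; field_simp
    simp only [this, Finset.sum_sub_distrib, ← Finset.mul_sum, hp1]
  rw [le_div_iff₀ (by positivity)]
  linarith

lemma entropy_bornProb_ge (hd : d ≠ 0) (hM : IsSIC M) (hρ : IsState ρ) :
    (Real.log (d * (d + 1)) - Real.log (1 + ∑ i, hρ.1.1.eigenvalues i ^ 2)) / Real.log 2 ≤
      ∑ i, entropyTerm (bornProb M ρ i) := by
  have h1 : 0 < 1 + ∑ i, hρ.1.1.eigenvalues i ^ 2 := by positivity
  have h := neg_logb_sum_sq_le (fun i => (bornProb_nonneg hM.1 hρ.1 i).1) (sum_bornProb hM.1 hρ.2)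
    (sum_bornProb_sq_le hd hM hρ) (by positivity)
  rwa [Real.log_div h1.ne' (by positivity), neg_sub] at h

/-! ### Nonemptiness of the sets under the infima -/

/-- A Naimark extension of a SIC: complete the `d` orthonormal vectors
`(conj (φ i a) / √d)_i` to an orthonormal basis. -/
lemma exists_isNaimarkExt (hd : d ≠ 0) (hM : IsSIC M) :
    ∃ (n : ℕ) (P : Fin (d ^ 2) → Matrix (Fin d × Fin n) (Fin d × Fin n) ℂ)
      (σ : Matrix (Fin n) (Fin n) ℂ), IsNaimarkExt M P σ := by
  obtain ⟨⟨-, hsum⟩, φ, hu, ho, hφ⟩ := hM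
  have : NeZero d := ⟨hd⟩
  -- Only the vectors with `m.2 = 0` matter. Indexing by pairs lets the completed basis be read as a
  -- unitary on system and ancilla, with ancilla state `|0⟩⟨0|`.
  let v : Fin d × Fin d → EuclideanSpace ℂ (Fin (d ^ 2)) := fun m =>
    WithLp.toLp 2 fun i => ((1 / Real.sqrt d : ℝ) : ℂ) * star (φ i m.1)
  have hs : ((1 / Real.sqrt d : ℝ) : ℂ) * ((1 / Real.sqrt d : ℝ) : ℂ) = 1 / (d : ℂ) := by
    rw [← Complex.ofReal_mul, div_mul_div_comm, Real.mul_self_sqrt (Nat.cast_nonneg d)]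
    simp
  have hsr : star ((1 / Real.sqrt d : ℝ) : ℂ) = ((1 / Real.sqrt d : ℝ) : ℂ) :=
    Complex.conj_ofReal _
  have hMv : ∀ i a a', M i a a' = star (v (a, 0) i) * v (a', 0) i := fun i a a' => by
    simp only [v, hφ, Matrix.smul_apply, ketbra, vecMulVec_apply, star_mul', star_star,
      hsr, Pi.star_apply, smul_eq_mul, ← hs]
    ring
  have horth : Orthonormal ℂ (Set.domRestrict {m : Fin d × Fin d | m.2 = 0} v) := by
    rw [orthonormal_iff_ite]
    rintro ⟨⟨a, b⟩, hb⟩ ⟨⟨a', b'⟩, hb'⟩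
    obtain rfl : b = 0 := hb
    obtain rfl : b' = 0 := hb'
    have h1 : inner ℂ (v (a, 0)) (v (a', 0)) = ∑ i, M i a a' := by
      rw [PiLp.inner_apply]
      exact Finset.sum_congr rfl fun i _ => by rw [hMv, RCLike.inner_apply, mul_comm]; rfl
    change inner ℂ (v (a, 0)) (v (a', 0)) = _
    rw [h1, ← Matrix.sum_apply, hsum, one_apply]
    simp
  obtain ⟨b, hb⟩ := horth.exists_orthonormalBasis_extension_of_card_eq (by simp [sq])
  have hb1 : ∀ m m', ∑ i, star (b m i) * b m' i = if m = m' then 1 else 0 := fun m m' => by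
    rw [← orthonormal_iff_ite.1 b.orthonormal m m', PiLp.inner_apply]
    exact Finset.sum_congr rfl fun i _ => by rw [RCLike.inner_apply, mul_comm]; rfl
  have hb2 : ∀ i j, ∑ m, star (b m j) * b m i = if i = j then 1 else 0 := fun i j => by
    have h := b.sum_inner_mul_inner (EuclideanSpace.single i (1 : ℂ))
      (EuclideanSpace.single j (1 : ℂ))
    simp only [EuclideanSpace.inner_single_left, EuclideanSpace.inner_single_right, map_one,
      one_mul, PiLp.single_apply] at h
    rw [apply_ite (starRingEnd ℂ), map_one, map_zero] at h
    simp only [eq_comm (a := i), ← h]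
    exact Finset.sum_congr rfl fun m _ => mul_comm _ _
  let P : Fin (d ^ 2) → Matrix (Fin d × Fin d) (Fin d × Fin d) ℂ :=
    fun i => ketbra fun m => star (b m i)
  have hPP : ∀ i j, P i * P j = (if i = j then (1 : ℂ) else 0) •
      vecMulVec (fun m => star (b m i)) (star fun m => star (b m j)) := fun i j => by
    simp only [P]
    rw [ketbra_mul_ketbra, ← hb2 i j]
    congr 1
    exact Finset.sum_congr rfl fun m _ => by simp [mul_comm]
  let σ : Matrix (Fin d) (Fin d) ℂ := ketbra (Pi.single 0 1)
  have hσu : IsUnitVec (Pi.single (0 : Fin d) (1 : ℂ)) := by simp [IsUnitVec]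
  refine ⟨d, P, σ, ⟨fun i => ⟨isHermitian_ketbra _, ?_⟩, fun i j hij => ?_, ?_⟩,
    ⟨posSemidef_ketbra _, trace_ketbra hσu⟩, fun i => ?_⟩
  · rw [hPP]; simp [P, ketbra]
  · rw [hPP]; simp [hij]
  · ext m m'
    rw [one_apply, ← hb1, Matrix.sum_apply]
    exact Finset.sum_congr rfl fun i _ => by simp [P, ketbra, vecMulVec_apply]
  · ext a a'
    rw [hMv, ← hb (a, 0) rfl, ← hb (a', 0) rfl]
    simp [traceQ, mul_apply, Fintype.sum_prod_type, σ, P, ketbra, vecMulVec_apply, one_apply,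
      Pi.single_apply]

end

lemma exists_pure_decomposition {κ : Type} [Fintype κ] [DecidableEq κ] {ρ : Matrix κ κ ℂ}
    (hρ : IsState ρ) : ∃ (k : ℕ) (q : Fin k → ℝ) (ψ : Fin k → κ → ℂ),
      (∀ j, 0 ≤ q j) ∧ ∑ j, q j = 1 ∧ (∀ j, IsUnitVec (ψ j)) ∧
      ρ = ∑ j, (q j : ℂ) • ketbra (ψ j) := by
  obtain ⟨W, hW, h⟩ := hρ.1.1.eq_conj_diagonal
  let e := (Fintype.equivFin κ).symm
  refine ⟨Fintype.card κ, fun j => hρ.1.1.eigenvalues (e j), fun j m => W m (e j),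
    fun j => hρ.1.eigenvalues_nonneg _, ?_, fun j => ?_, ?_⟩
  · rw [e.sum_comp (fun i => hρ.1.1.eigenvalues i), hρ.sum_eigenvalues]
  · have := congrFun (congrFun hW (e j)) (e j)
    rw [one_apply_eq, mul_apply] at this
    exact this
  · rw [e.sum_comp (fun i => (hρ.1.1.eigenvalues i : ℂ) • ketbra fun m => W m i)]
    conv_lhs => rw [h]
    ext m m'
    simp only [mul_apply (N := Wᴴ), mul_diagonal, Matrix.sum_apply, Matrix.smul_apply, ketbra,
      vecMulVec_apply, conjTranspose_apply, Pi.star_apply, smul_eq_mul]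
    exact Finset.sum_congr rfl fun i _ => by ring

lemma IsState.kronecker {α β : Type} [Fintype α] [Fintype β] {ρ : Matrix α α ℂ}
    {σ : Matrix β β ℂ} (hρ : IsState ρ) (hσ : IsState σ) : IsState (ρ ⊗ₖ σ) :=
  ⟨hρ.1.kronecker hσ.1, by rw [trace_kronecker, hρ.2, hσ.2, one_mul]⟩

/-- The real infimum of the empty set is `0`, so a lower bound passes to it only once a state and an
extension exist. -/
lemma le_sourceIndepRand {d : ℕ} {M : Fin (d ^ 2) → Matrix (Fin d) (Fin d) ℂ} (hd : d ≠ 0)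
    (hM : IsSIC M)
    {R : ∀ {κ : Type} [Fintype κ] [DecidableEq κ],
      Matrix κ κ ℂ → (Fin (d ^ 2) → Matrix κ κ ℂ) → ℝ} {c : ℝ}
    (h : ∀ ρ, IsState ρ → ∀ (n : ℕ)
      (P : Fin (d ^ 2) → Matrix (Fin d × Fin n) (Fin d × Fin n) ℂ) (σ : Matrix (Fin n) (Fin n) ℂ),
      IsNaimarkExt M P σ → c ≤ R (ρ ⊗ₖ σ) P) :
    c ≤ sourceIndepRand R M := by
  have : NeZero d := ⟨hd⟩
  refine le_csInf ⟨_, ketbra (Pi.single 0 1), ⟨posSemidef_ketbra _,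
    trace_ketbra (by simp [IsUnitVec])⟩, rfl⟩ ?_
  rintro _ ⟨ρ, hρ, rfl⟩
  obtain ⟨n, P, σ, hN⟩ := exists_isNaimarkExt hd hM
  refine le_csInf ⟨_, n, P, σ, hN, rfl⟩ ?_
  rintro _ ⟨n, P, σ, hN, rfl⟩
  exact h ρ hρ n P σ hN

end

/-! ### The strict lower bound -/

theorem theorem3 (d : ℕ) (hd : 2 ≤ d) (M : Fin (d ^ 2) → Matrix (Fin d) (Fin d) ℂ)
    (hM : IsSIC M) :
    Real.logb 2 (((d : ℝ) + 1) / 2) < sourceIndepRand pvmRandC M ∧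
    Real.logb 2 (((d : ℝ) + 1) / 2) < sourceIndepRand pvmRandQ M := by
  have hd0 : d ≠ 0 := by omega
  have hdp : (0 : ℝ) < d := by positivity
  have hl : 0 < Real.log 2 := Real.log_pos one_lt_two
  obtain ⟨c, hc, hbound⟩ := exists_bound_entropy_add_log_purity hd
  have hlt : Real.logb 2 (((d : ℝ) + 1) / 2) < (Real.log (d * (d + 1)) - c) / Real.log 2 := by
    rw [Real.logb, div_lt_div_iff_of_pos_right hl, Real.log_div (by positivity) two_ne_zero,
      Real.log_mul hdp.ne' (by positivity)]
    rw [Real.log_mul two_ne_zero hdp.ne'] at hc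
    linarith
  have hH : ∀ ρ, ∀ hρ : IsState ρ, (Real.log (d * (d + 1)) - c) / Real.log 2 ≤
      ∑ i, entropyTerm (bornProb M ρ i) - ∑ i, entropyTerm (hρ.1.1.eigenvalues i) :=
    fun ρ hρ => by
      have h1 := entropy_bornProb_ge hd0 hM hρ
      have h2 := hbound _ hρ.eigenvalues_mem_stdSimplex
      simp only [entropyTerm, ← Finset.sum_div] at h1 ⊢
      rw [← sub_div, div_le_div_iff_of_pos_right hl]
      rw [div_le_div_iff_of_pos_right hl] at h1
      linarith
  have hnn : ∀ ρ : Matrix (Fin d) (Fin d) ℂ, ∀ hρ : IsState ρ, 0 ≤ ∑ i, entropyTerm (hρ.1.1.eigenvalues i) :=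
    fun ρ hρ => Finset.sum_nonneg fun i _ => by
      have hx := hρ.eigenvalues_mem_stdSimplex
      refine div_nonneg (Real.negMulLog_nonneg (hx.1 i) ?_) hl.le
      rw [← hx.2]
      exact Finset.single_le_sum (fun j _ => hx.1 j) (Finset.mem_univ i)
  generalize (Real.log (d * (d + 1)) - c) / Real.log 2 = B at hlt hH
  refine ⟨hlt.trans_le (le_sourceIndepRand hd0 hM ?_), hlt.trans_le (le_sourceIndepRand hd0 hM ?_)⟩
  · intro ρ hρ n P σ hN
    obtain ⟨k, q, ψ, h1, h2, h3, h4⟩ := exists_pure_decomposition (hρ.kronecker hN.2.1)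
    refine le_csInf ⟨_, k, q, ψ, h1, h2, h3, h4, rfl⟩ ?_
    rintro _ ⟨k, q, ψ, h1, h2, h3, h4, rfl⟩
    rw [← one_mul B, ← h2, Finset.sum_mul]
    refine Finset.sum_le_sum fun j _ => ?_
    -- A vector of weight zero need not lie in the range of `1 ⊗ σ`, but contributes nothing.
    rcases eq_or_ne (q j) 0 with hj | hj
    · simp [hj]
    refine mul_le_mul_of_nonneg_left ?_ (h1 j)
    obtain ⟨χ, hχ⟩ := mem_range_of_decomposition hN.2.1.1.1 h1 h4 hj
    have hs := (h3 j).isState_traceQ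
    rw [vnEntropy_dephase_ketbra hN.1 (sum_bornProb hM.1 hs.2)
      (star_dotProduct_mulVec_naimark hd0 hM hN hχ)]
    -- The bound on `H - S` is applied to the reduced state of `ψ j`, and `S ≥ 0` is then dropped.
    linarith [hH _ hs, hnn _ hs]
  · intro ρ hρ n P σ hN
    rw [pvmRandQ_naimark hd0 hM hN hρ, vnEntropy_eq_sum_eigenvalues hρ.1.1]
    exact hH ρ hρ
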